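/- Let $M$ be a finite-dimensional, Hausdorff, second countable manifold (without boundary) of class $C^1$; in particular $M$ may be any smooth manifold. Let $C$ be a closed cone structure on $M$, that is, an assignment $p\mapsto C_p\subset T_pM\setminus\{0\}$ of non-empty closed (in $T_pM\setminus\{0\}$) convex cones which are sharp ($C_p\cup\{0\}$ contains no line) such that $\bigcup_p C_p$ is closed in the slit tangent bundle $TM\setminus 0$. A causal curve is a locally Lipschitz curve $\gamma:[a,b]\to M$, $a<b$, with $\dot\gamma(t)\in C_{\gamma(t)}$ for almost every $t$. Write $p<q$ if there is a causal curve from $p$ to $q$, and $p\le q$ if $p<q$ or $p=q$. Set $J=\{(p,q): p\le q\}$, and for $S\subset M$ let $J^+(S)$ and $J^-(S)$ be the sets of points $q$ such that $p\le q$, respectively $q\le p$, for some $p\in S$. Assume that $(M,C)$ is causal, i.e. there is no $p$ with $p<p$. Then the following are equivalent: 1. for every compact $K\subset M$ the causally convex hull $J^+(K)\cap J^-(K)$ is closed in $M$; 2. $J$ is closed in $M\times M$. -/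

import Mathlib

open Set Filter Topology MeasureTheory
open scoped Manifold ContDiff NNReal

/-- A closed cone structure on a manifold `M` modelled on `ℝⁿ`: a distribution `p ↦ C_p ⊆ T_pM \ 0`
of non-empty closed sharp convex cones whose union is closed in the slit tangent bundle `TM \ 0`. -/
structure ClosedConeStructure (n : ℕ) (M : Type*) [TopologicalSpace M]
    [ChartedSpace (EuclideanSpace ℝ (Fin n)) M] [IsManifold (𝓡 n) 1 M] where
  /-- The cone `C_p` at `p`. -/
  cone : ∀ p : M, Set (TangentSpace (𝓡 n) p)
  zero_notMem : ∀ p : M, (0 : TangentSpace (𝓡 n) p) ∉ cone p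
  nonempty : ∀ p : M, (cone p).Nonempty
  smul_mem : ∀ (p : M) (s : ℝ) (v : TangentSpace (𝓡 n) p), 0 < s → v ∈ cone p → s • v ∈ cone p
  convex : ∀ p : M, Convex ℝ (cone p)
  /-- `C_p ∪ {0}` contains no line. -/
  sharp : ∀ (p : M) (v : TangentSpace (𝓡 n) p), v ∈ cone p → -v ∉ cone p
  /-- `C_p` is closed in `T_pM \ 0`. -/
  isClosed_cone : ∀ p : M, IsClosed {v : {v : TangentSpace (𝓡 n) p // v ≠ 0} | v.1 ∈ cone p}
  /-- `C = ⋃ C_p` is closed in `TM \ 0`. -/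
  isClosed_total :
    IsClosed {v : {v : TangentBundle (𝓡 n) M // v.2 ≠ 0} | v.1.2 ∈ cone v.1.1}

/-- The curve `γ` is continuous on `[a, b]` and, read in charts, locally Lipschitz there. -/
def LocLipschitzCurve (n : ℕ) {M : Type*} [TopologicalSpace M]
    [ChartedSpace (EuclideanSpace ℝ (Fin n)) M] (γ : ℝ → M) (a b : ℝ) : Prop :=
  ContinuousOn γ (Icc a b) ∧
    ∀ t ∈ Icc a b, ∃ K : ℝ≥0, ∃ s ∈ 𝓝[Icc a b] t,
      MapsTo γ s (chartAt (EuclideanSpace ℝ (Fin n)) (γ t)).source ∧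
        LipschitzOnWith K (chartAt (EuclideanSpace ℝ (Fin n)) (γ t) ∘ γ) s

namespace ClosedConeStructure

variable {n : ℕ} {M : Type*} [TopologicalSpace M] [ChartedSpace (EuclideanSpace ℝ (Fin n)) M]
  [IsManifold (𝓡 n) 1 M]

/-- `γ` restricted to `[a, b]` is a (continuous) causal curve: it is locally Lipschitz, and at almost
every time its velocity exists and lies in the cone. -/
def IsCausalCurve (C : ClosedConeStructure n M) (γ : ℝ → M) (a b : ℝ) : Prop :=
  a < b ∧ LocLipschitzCurve n γ a b ∧
    ∀ᵐ t ∂(volume.restrict (Icc a b)),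
      MDifferentiableAt 𝓘(ℝ, ℝ) (𝓡 n) γ t ∧
        mfderiv 𝓘(ℝ, ℝ) (𝓡 n) γ t (1 : ℝ) ∈ C.cone (γ t)

/-- `p < q`: some causal curve goes from `p` to `q`. -/
def CausalLT (C : ClosedConeStructure n M) (p q : M) : Prop :=
  ∃ (γ : ℝ → M) (a b : ℝ), C.IsCausalCurve γ a b ∧ γ a = p ∧ γ b = q

/-- `p ≤ q`: `p < q` or `p = q`. -/
def CausalLE (C : ClosedConeStructure n M) (p q : M) : Prop :=
  C.CausalLT p q ∨ p = q

/-- Causality: there is no closed causal curve. -/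
def IsCausal (C : ClosedConeStructure n M) : Prop :=
  ∀ p : M, ¬ C.CausalLT p p

/-- The causal relation `J ⊆ M × M`. -/
def causalRelation (C : ClosedConeStructure n M) : Set (M × M) :=
  {x | C.CausalLE x.1 x.2}

/-- The causal future `J⁺(S)`. -/
def causalFuture (C : ClosedConeStructure n M) (S : Set M) : Set M :=
  {q | ∃ p ∈ S, C.CausalLE p q}

/-- The causal past `J⁻(S)`. -/
def causalPast (C : ClosedConeStructure n M) (S : Set M) : Set M :=
  {q | ∃ p ∈ S, C.CausalLE q p}

/-- The causally convex hull `J⁺(S) ∩ J⁻(S)`. -/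
def causalHull (C : ClosedConeStructure n M) (S : Set M) : Set M :=
  C.causalFuture S ∩ C.causalPast S

end ClosedConeStructure

/-!
# Causal simplicity from closed causally convex hulls

If `J` is closed, then `J⁺(K)` and `J⁻(K)` are projections of closed sets along the compact set `K`,
so the hulls are closed.

Conversely, let `uᵢ ≤ vᵢ` with `uᵢ → p`, `vᵢ → q` and `p ≠ q`. Causal curves from `uᵢ` to `vᵢ` have
to leave a small ball around `p`, and their initial pieces accumulate on a causal curve that starts
at `p`; its endpoint `p' > p` is a limit of points between `uᵢ` and `vᵢ` (`exists_limit_future`).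
For every tail of the two sequences, `p'` therefore lies in the hull, closed by assumption, of the
compact set made of the tail, `p` and `q`. Since `p' ≤ p` violates causality, either `p' ≤ q`, which
suffices, or `p' ≤ vᵢ` for arbitrarily large `i`, possibly through some `uᵢ`. In the latter case
the past version of the limit (`exists_limit_past`) yields `q' < q`, a limit of points between `p'`
and `vᵢ`; it is in the hull of `p'`, `q` and the `vᵢ`, and as `q ≤ q'` is excluded, `p' ≤ q`
(`causalLE_of_tendsto_right`, `causalLE_of_tendsto`).

The limit of curves is taken in a chart. Sharpness gives a linear functional `f` with
`c ‖w‖ ≤ f w` on all cones near `p`, so curves parametrized by `f` are uniformly Lipschitz and have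
a pointwise limit along any ultrafilter. Velocities do not pass to the limit; instead, causal curves
are described by the integrated condition `FollowsCones`: a functional that is non-negative on all
the cones met along a piece of the curve does not decrease over that piece. This condition does not
depend on the parametrization, it passes to limits because the cones are upper semicontinuous, and
at a point of differentiability it puts the velocity of the limit in the closed convex cone, by
Hahn–Banach (`FollowsCones.exists_limit`).
-/

/-! ### Closed cone fields in a vector space -/

section VectorSpace

variable {E : Type*} [NormedAddCommGroup E] [NormedSpace ℝ E]

/-- A field of closed convex cones `G y`, `y ∈ B`, with closed graph. Unlike in a closed cone
structure the origin belongs to the cones, so that closedness refers to the whole of `E × E`. -/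
structure IsClosedConeField (G : E → Set E) (B : Set E) : Prop where
  isClosed : IsClosed {z : E × E | z.1 ∈ B ∧ z.2 ∈ G z.1}
  zero_mem : ∀ y ∈ B, 0 ∈ G y
  convex : ∀ y ∈ B, Convex ℝ (G y)
  smul_mem : ∀ y ∈ B, ∀ s : ℝ, 0 < s → ∀ w ∈ G y, s • w ∈ G y

/-- The curve `x` follows the cone field `G` on `[a, b]` in the integrated sense: it is continuous,
and a linear functional non-negative on the cones along `[t₁, t₂]` satisfies `g (x t₁) ≤ g (x t₂)`.
For Lipschitz curves this follows from `x' ∈ G x` almost everywhere, but neither a derivative nor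
a particular parametrization is involved. -/
structure FollowsCones (G : E → Set E) (x : ℝ → E) (a b : ℝ) : Prop where
  continuousOn : ContinuousOn x (Icc a b)
  le_of_nonneg : ∀ t₁ ∈ Icc a b, ∀ t₂ ∈ Icc a b, t₁ ≤ t₂ → ∀ g : E →L[ℝ] ℝ,
    (∀ t ∈ Icc t₁ t₂, ∀ w ∈ G (x t), 0 ≤ g w) → g (x t₁) ≤ g (x t₂)

namespace IsClosedConeField

variable {G : E → Set E} {B : Set E}

theorem neg (hG : IsClosedConeField G B) : IsClosedConeField (fun y => -G y) B where
  isClosed := by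
    have := hG.isClosed.preimage (f := fun z : E × E => (z.1, -z.2)) (by fun_prop)
    simpa using this
  zero_mem y hy := by simpa using hG.zero_mem y hy
  convex y hy := (hG.convex y hy).neg
  smul_mem y hy s hs w hw := by
    simpa using hG.smul_mem y hy s hs (-w) hw

theorem isClosed_apply (hG : IsClosedConeField G B) {y : E} (hy : y ∈ B) : IsClosed (G y) := by
  have := hG.isClosed.preimage (f := fun w : E => (y, w)) (by fun_prop)
  simpa [hy] using this

/-- Farkas' lemma: a vector outside the cone is separated from it by a functional that is
non-negative on the cone. -/
theorem exists_separating (hG : IsClosedConeField G B) {y : E} (hy : y ∈ B) {v : E}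
    (hv : v ∉ G y) : ∃ g : E →L[ℝ] ℝ, (∀ w ∈ G y, 0 ≤ g w) ∧ g v < 0 := by
  obtain ⟨g, u, hgv, hgu⟩ := geometric_hahn_banach_point_closed (hG.convex y hy)
    (hG.isClosed_apply hy) hv
  have hu0 : u < 0 := by simpa using hgu 0 (hG.zero_mem y hy)
  refine ⟨g, fun w hw => ?_, hgv.trans hu0⟩
  by_contra! hneg
  have := hgu _ (hG.smul_mem y hy (u / g w) (div_pos_of_neg_of_neg hu0 hneg) w hw)
  rw [map_smul, smul_eq_mul, div_mul_cancel₀ _ hneg.ne] at this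
  exact lt_irrefl _ this

/-- If some functional dominates the norm on the cone, membership in the cone is tested by the
functionals that are strictly positive on its non-zero vectors. -/
theorem mem_of_forall_pos (hG : IsClosedConeField G B) {y : E} (hy : y ∈ B) {f : E →L[ℝ] ℝ} {c : ℝ}
    (hc : 0 < c) (hf : ∀ w ∈ G y, c * ‖w‖ ≤ f w) {v : E}
    (hv : ∀ g : E →L[ℝ] ℝ, (∀ w ∈ G y, w ≠ 0 → 0 < g w) → 0 ≤ g v) : v ∈ G y := by
  by_contra hvG
  obtain ⟨g, hg0, hgv0⟩ := hG.exists_separating hy hvG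
  -- perturb `g` to make it strictly positive on the cone, keeping it negative at `v`
  obtain ⟨ε, hε, hεv⟩ : ∃ ε : ℝ, 0 < ε ∧ g v + ε * f v < 0 := by
    have : Tendsto (fun ε : ℝ => g v + ε * f v) (𝓝[>] 0) (𝓝 (g v + 0 * f v)) :=
      (Continuous.tendsto (by fun_prop) 0).mono_left nhdsWithin_le_nhds
    rw [zero_mul, add_zero] at this
    obtain ⟨ε, h1, h2⟩ := ((this.eventually_lt_const hgv0).and self_mem_nhdsWithin).exists
    exact ⟨ε, h2, h1⟩
  have := hv (g + ε • f) (fun w hw hw0 => by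
    have := mul_pos hc (norm_pos_iff.2 hw0)
    have h1 := hg0 w hw
    have h2 := mul_pos hε (this.trans_le (hf w hw))
    simpa using add_pos_of_nonneg_of_pos h1 h2)
  simp at this
  linarith

variable [FiniteDimensional ℝ E]

/-- Upper semicontinuity of the cone field: a positively homogeneous function that is positive on
the non-zero vectors of one cone is non-negative on the nearby cones. -/
theorem eventually_nonneg (hG : IsClosedConeField G B) (hB : IsCompact B) {h : E → ℝ}
    (hc : Continuous h) (hh : ∀ s : ℝ, 0 < s → ∀ w, h (s • w) = s * h w) {y : E}
    (hpos : ∀ w ∈ G y, w ≠ 0 → 0 < h w) :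
    ∀ᶠ z in 𝓝 y, z ∈ B → ∀ w ∈ G z, 0 ≤ h w := by
  have h0 : h 0 = 0 := by
    have := hh 2 two_pos 0
    rw [smul_zero] at this
    linarith
  set Z : Set (E × E) := {z : E × E | z.1 ∈ B ∧ z.2 ∈ G z.1} ∩ {z | h z.2 ≤ 0} with hZ
  have hZc : IsClosed Z := hG.isClosed.inter (isClosed_le (hc.comp continuous_snd) continuous_const)
  have hcomp : IsCompact (Z ∩ B ×ˢ Metric.sphere (0 : E) 1) :=
    (hB.prod (isCompact_sphere 0 1)).inter_left hZc
  have himg := (hcomp.image continuous_fst).isClosed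
  have hy : y ∉ Prod.fst '' (Z ∩ B ×ˢ Metric.sphere (0 : E) 1) := by
    rintro ⟨⟨y', w⟩, ⟨⟨⟨_, hw⟩, hle⟩, -, hw1⟩, rfl⟩
    have : w ≠ 0 := by
      rintro rfl
      simp at hw1
    exact absurd (hpos w hw this) (not_lt.2 hle)
  filter_upwards [himg.isOpen_compl.mem_nhds hy] with z hz hzB w hw
  by_cases hw0 : w = 0
  · rw [hw0, h0]
  by_contra! hneg
  have hn : 0 < ‖w‖⁻¹ := inv_pos.2 (norm_pos_iff.2 hw0)
  refine hz ⟨(z, ‖w‖⁻¹ • w), ⟨⟨⟨hzB, hG.smul_mem z hzB _ hn w hw⟩, ?_⟩, hzB, ?_⟩, rfl⟩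
  · change h (‖w‖⁻¹ • w) ≤ 0
    rw [hh _ hn]
    exact (mul_neg_of_pos_of_neg hn hneg).le
  · simp [norm_smul, hw0]

/-- A closed convex cone without lines has a functional that is positive on its non-zero vectors. -/
theorem exists_pos_functional (hG : IsClosedConeField G B) {y : E} (hy : y ∈ B)
    (hs : ∀ w ∈ G y, -w ∈ G y → w = 0) :
    ∃ (f : E →L[ℝ] ℝ), ∀ w ∈ G y, w ≠ 0 → 0 < f w := by
  have hK : IsCompact (G y ∩ Metric.sphere (0 : E) 1) :=
    (isCompact_sphere 0 1).inter_left (hG.isClosed_apply hy)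
  -- a functional non-negative on the cone and positive on all its unit vectors is a finite sum of
  -- functionals, each positive near one unit vector `w` because it separates `-w` from the cone
  have key : ∃ f : E →L[ℝ] ℝ, (∀ w ∈ G y, 0 ≤ f w) ∧
      ∀ w ∈ G y ∩ Metric.sphere (0 : E) 1, w ∈ G y → 0 < f w := by
    refine hK.induction_on (p := fun s => ∃ f : E →L[ℝ] ℝ, (∀ w ∈ G y, 0 ≤ f w) ∧
      ∀ w ∈ s, w ∈ G y → 0 < f w) ⟨0, by simp⟩ ?_ ?_ ?_
    · rintro s t hst ⟨f, hf, hft⟩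
      exact ⟨f, hf, fun w hw => hft w (hst hw)⟩
    · rintro s t ⟨f, hf, hfs⟩ ⟨g, hg, hgt⟩
      refine ⟨f + g, fun w hw => add_nonneg (hf w hw) (hg w hw), fun w hw hwG => ?_⟩
      rcases hw with hw | hw
      · exact add_pos_of_pos_of_nonneg (hfs w hw hwG) (hg w hwG)
      · exact add_pos_of_nonneg_of_pos (hf w hwG) (hgt w hw hwG)
    · rintro w ⟨hw, hw1⟩
      have hw0 : w ≠ 0 := by
        rintro rfl
        simp at hw1
      obtain ⟨g, hg, hgw⟩ := hG.exists_separating hy (fun h => hw0 (hs w hw h))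
      have hpos : 0 < g w := by simpa using hgw
      exact ⟨{v | 0 < g v}, mem_nhdsWithin_of_mem_nhds
        ((isOpen_lt continuous_const g.continuous).mem_nhds hpos), g, hg, fun v hv _ => hv⟩
  obtain ⟨f, -, hf⟩ := key
  refine ⟨f, fun w hw hw0 => ?_⟩
  have hn := inv_pos.2 (norm_pos_iff.2 hw0)
  have hw' := hG.smul_mem y hy _ hn w hw
  have := hf _ ⟨hw', by simp [norm_smul, hw0]⟩ hw'
  rw [map_smul, smul_eq_mul] at this
  exact pos_of_mul_pos_right this hn.le

/-- A functional positive on one cone of the field satisfies a uniform bound `c ‖w‖ ≤ f w` on the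
nearby cones. -/
theorem exists_eventually_norm_le (hG : IsClosedConeField G B) (hB : IsCompact B) {y : E}
    (hy : y ∈ B) (f : E →L[ℝ] ℝ) (hf : ∀ w ∈ G y, w ≠ 0 → 0 < f w) :
    ∃ c : ℝ, 0 < c ∧ ∀ᶠ z in 𝓝 y, z ∈ B → ∀ w ∈ G z, c * ‖w‖ ≤ f w := by
  have hK : IsCompact (G y ∩ Metric.sphere (0 : E) 1) :=
    (isCompact_sphere 0 1).inter_left (hG.isClosed_apply hy)
  obtain ⟨c, hc, hcf⟩ : ∃ c : ℝ, 0 < c ∧ ∀ w ∈ G y ∩ Metric.sphere (0 : E) 1, c ≤ f w := by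
    rcases (G y ∩ Metric.sphere (0 : E) 1).eq_empty_or_nonempty with h | h
    · exact ⟨1, one_pos, by simp [h]⟩
    · obtain ⟨v, hv, hmin⟩ := hK.exists_isMinOn h f.continuous.continuousOn
      refine ⟨f v, hf v hv.1 ?_, hmin⟩
      rintro rfl
      simpa using hv.2
  refine ⟨c / 2, half_pos hc, ?_⟩
  have := hG.eventually_nonneg hB (h := fun w => f w - c / 2 * ‖w‖) (by fun_prop) (y := y)
    (fun s hs w => by
      rw [map_smul, norm_smul, Real.norm_of_nonneg hs.le, smul_eq_mul]
      ring) (fun w hw hw0 => by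
      have hn := norm_pos_iff.2 hw0
      have := hcf (‖w‖⁻¹ • w)
        ⟨hG.smul_mem y hy _ (inv_pos.2 hn) w hw, by simp [norm_smul, hw0]⟩
      rw [map_smul, smul_eq_mul, le_inv_mul_iff₀ hn] at this
      nlinarith)
  filter_upwards [this] with z hz hzB w hw
  exact sub_nonneg.1 (hz hzB w hw)

end IsClosedConeField

namespace FollowsCones

variable {G : E → Set E} {x : ℝ → E} {a b : ℝ}

/-- Reversing time replaces the cones by their opposites. -/
theorem neg (h : FollowsCones G x a b) :
    FollowsCones (fun y => -G y) (fun t => x (-t)) (-b) (-a) where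
  continuousOn := h.continuousOn.comp continuousOn_neg (fun t ht => by
    constructor <;> linarith [ht.1, ht.2])
  le_of_nonneg t₁ h₁ t₂ h₂ h₁₂ g hg := by
    have := h.le_of_nonneg (-t₂) ⟨by linarith [h₂.2], by linarith [h₂.1]⟩
      (-t₁) ⟨by linarith [h₁.2], by linarith [h₁.1]⟩ (by linarith) (-g) (fun t ht w hw => by
        have := hg (-t) ⟨by linarith [ht.2], by linarith [ht.1]⟩ (-w) (by simpa using hw)
        simpa using this)
    simpa using this

/-- A functional dominating the norm on the cones also dominates the increments of the curve: by
duality the increment has the same norm as its value under a functional `g` with `‖g‖ ≤ 1`, and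
`f - c g` is non-negative on the cones. -/
theorem norm_sub_le (h : FollowsCones G x a b) {f : E →L[ℝ] ℝ} {c : ℝ}
    (hc : 0 ≤ c) (hf : ∀ t ∈ Icc a b, ∀ w ∈ G (x t), c * ‖w‖ ≤ f w) {t₁ t₂ : ℝ} (h₁ : t₁ ∈ Icc a b)
    (h₂ : t₂ ∈ Icc a b) (h₁₂ : t₁ ≤ t₂) : c * ‖x t₂ - x t₁‖ ≤ f (x t₂) - f (x t₁) := by
  obtain ⟨g, hg1, hg⟩ := exists_dual_vector'' ℝ (x t₂ - x t₁)
  have := h.le_of_nonneg t₁ h₁ t₂ h₂ h₁₂ (f - c • g) (fun t ht w hw => by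
    have h1 := hf t ⟨h₁.1.trans ht.1, ht.2.trans h₂.2⟩ w hw
    have h2 : g w ≤ ‖w‖ := (le_abs_self _).trans
      ((g.le_opNorm w).trans (mul_le_of_le_one_left (norm_nonneg w) hg1))
    have h3 := mul_le_mul_of_nonneg_left h2 hc
    simp
    linarith)
  rw [map_sub] at hg
  simp at this hg
  rw [← hg]
  linarith

end FollowsCones

variable [FiniteDimensional ℝ E]

/-- Curves following a cone field in a compact set `B`, on which `f` dominates the norm on the
cones, with initial points tending to `x₀` and increments bounded below, accumulate on a Lipschitz curve
which starts at `x₀` and whose velocity lies in the cones almost everywhere. -/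
theorem FollowsCones.exists_limit {G : E → Set E} {B : Set E} (hG : IsClosedConeField G B)
    (hB : IsCompact B) {f : E →L[ℝ] ℝ} {c : ℝ} (hc : 0 < c)
    (hf : ∀ y ∈ B, ∀ w ∈ G y, c * ‖w‖ ≤ f w) {ι : Type*} (𝒰 : Ultrafilter ι)
    {x : ι → ℝ → E} {a b : ι → ℝ} (hab : ∀ᶠ n in 𝒰, a n ≤ b n)
    (hx : ∀ᶠ n in 𝒰, FollowsCones G (x n) (a n) (b n))
    (hxB : ∀ᶠ n in 𝒰, MapsTo (x n) (Icc (a n) (b n)) B) {x₀ : E}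
    (hx₀ : Tendsto (fun n => x n (a n)) 𝒰 (𝓝 x₀)) {δ : ℝ} (hδ : 0 < δ)
    (hδx : ∀ᶠ n in 𝒰, δ ≤ ‖x n (b n) - x n (a n)‖) :
    ∃ T : ℝ, 0 < T ∧ ∃ y : ℝ → E, y 0 = x₀ ∧ MapsTo y (Icc 0 T) B ∧
      (∃ K : ℝ≥0, LipschitzOnWith K y (Icc 0 T)) ∧
      (∀ᵐ s ∂(volume.restrict (Icc 0 T)), ∃ w ∈ G (y s), w ≠ 0 ∧ HasDerivAt y w s) ∧
      ∀ s ∈ Icc 0 T, ∃ t : ι → ℝ, (∀ᶠ n in 𝒰, t n ∈ Icc (a n) (b n)) ∧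
        Tendsto (fun n => x n (t n)) 𝒰 (𝓝 (y s)) := by
  set T := c * δ with hT
  have hT0 : 0 < T := mul_pos hc hδ
  -- the curves, parametrized by the increase of `f` from their first endpoint
  have hex : ∀ n, ∃ t : ℝ → ℝ, (a n ≤ b n ∧ FollowsCones G (x n) (a n) (b n) ∧
      MapsTo (x n) (Icc (a n) (b n)) B ∧ δ ≤ ‖x n (b n) - x n (a n)‖) → ∀ s ∈ Icc 0 T,
      t s ∈ Icc (a n) (b n) ∧ f (x n (t s)) = f (x n (a n)) + s := by
    intro n
    by_cases h : a n ≤ b n ∧ FollowsCones G (x n) (a n) (b n) ∧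
      MapsTo (x n) (Icc (a n) (b n)) B ∧ δ ≤ ‖x n (b n) - x n (a n)‖
    · obtain ⟨h1, h2, h3, h4⟩ := h
      have h5 := h2.norm_sub_le hc.le (fun t ht => hf _ (h3 ht)) (left_mem_Icc.2 h1)
        (right_mem_Icc.2 h1) h1
      have h6 := mul_le_mul_of_nonneg_left h4 hc.le
      have key : ∀ s, ∃ t, s ∈ Icc 0 T → t ∈ Icc (a n) (b n) ∧
          f (x n t) = f (x n (a n)) + s := by
        intro s
        by_cases hs : s ∈ Icc 0 T
        · obtain ⟨t, ht, hts⟩ := intermediate_value_Icc h1 (f.continuous.comp_continuousOn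
            h2.continuousOn) (show f (x n (a n)) + s ∈ Icc _ _ from
              ⟨by simpa using hs.1, by simp; linarith [hs.2]⟩)
          exact ⟨t, fun _ => ⟨ht, hts⟩⟩
        · exact ⟨0, fun h => absurd h hs⟩
      choose t ht using key
      exact ⟨t, fun _ s hs => ht s hs⟩
    · exact ⟨0, fun h' => absurd h' h⟩
  choose t ht using hex
  have hgood : ∀ᶠ n in 𝒰, FollowsCones G (x n) (a n) (b n) ∧
      MapsTo (x n) (Icc (a n) (b n)) B ∧ ∀ s ∈ Icc 0 T,
      t n s ∈ Icc (a n) (b n) ∧ f (x n (t n s)) = f (x n (a n)) + s := by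
    filter_upwards [hab, hx, hxB, hδx] with n h1 h2 h3 h4
    exact ⟨h2, h3, ht n ⟨h1, h2, h3, h4⟩⟩
  clear ht
  have hlim : ∀ s, ∃ y, s ∈ Icc 0 T → y ∈ B ∧ Tendsto (fun n => x n (t n s)) 𝒰 (𝓝 y) := by
    intro s
    by_cases hs : s ∈ Icc 0 T
    · obtain ⟨y, hy, hle⟩ := hB.ultrafilter_le_nhds (𝒰.map fun n => x n (t n s)) (by
        rw [le_principal_iff]
        change ∀ᶠ n in 𝒰, x n (t n s) ∈ B
        filter_upwards [hgood] with n hn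
        exact hn.2.1 (hn.2.2 s hs).1)
      exact ⟨y, fun _ => ⟨hy, hle⟩⟩
    · exact ⟨0, fun h => absurd h hs⟩
  choose y hy using hlim
  have h0T : (0 : ℝ) ∈ Icc 0 T := ⟨le_rfl, hT0.le⟩
  have hfy : ∀ s ∈ Icc 0 T, f (y s) = f x₀ + s := by
    intro s hs
    have h1 := (f.continuous.tendsto _).comp (hy s hs).2
    have h2 : Tendsto (fun n => f (x n (a n)) + s) 𝒰 (𝓝 (f x₀ + s)) :=
      ((f.continuous.tendsto _).comp hx₀).add_const s
    refine tendsto_nhds_unique (h1.congr' ?_) h2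
    filter_upwards [hgood] with n hn
    exact (hn.2.2 s hs).2
  -- along each curve the parameter is strictly monotone in the increase of `f`
  have htmono : ∀ᶠ n in 𝒰, ∀ s₁ ∈ Icc 0 T, ∀ s₂ ∈ Icc 0 T, s₁ < s₂ → t n s₁ ≤ t n s₂ := by
    filter_upwards [hgood] with n hn s₁ h₁ s₂ h₂ h₁₂
    by_contra! hlt
    have := hn.1.norm_sub_le hc.le (fun t ht => hf _ (hn.2.1 ht)) (hn.2.2 s₂ h₂).1
      (hn.2.2 s₁ h₁).1 hlt.le
    rw [(hn.2.2 s₁ h₁).2, (hn.2.2 s₂ h₂).2] at this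
    have := (mul_nonneg hc.le (norm_nonneg _)).trans this
    linarith
  have hlip : ∀ s₁ ∈ Icc 0 T, ∀ s₂ ∈ Icc 0 T, s₁ ≤ s₂ → ‖y s₂ - y s₁‖ ≤ c⁻¹ * (s₂ - s₁) := by
    intro s₁ h₁ s₂ h₂ h₁₂
    rcases h₁₂.eq_or_lt with rfl | h₁₂
    · simp
    refine le_of_tendsto ((hy s₂ h₂).2.sub (hy s₁ h₁).2).norm ?_
    filter_upwards [hgood, htmono] with n hn hm
    have := hn.1.norm_sub_le hc.le (fun t ht => hf _ (hn.2.1 ht)) (hn.2.2 s₁ h₁).1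
      (hn.2.2 s₂ h₂).1 (hm s₁ h₁ s₂ h₂ h₁₂)
    rw [(hn.2.2 s₁ h₁).2, (hn.2.2 s₂ h₂).2] at this
    rw [le_inv_mul_iff₀ hc]
    linarith
  have hLip : LipschitzOnWith (Real.toNNReal c⁻¹) y (Icc 0 T) := by
    refine LipschitzOnWith.of_dist_le_mul fun s₁ h₁ s₂ h₂ => ?_
    rw [Real.coe_toNNReal _ (inv_pos.2 hc).le]
    rcases le_total s₁ s₂ with h | h
    · rw [dist_comm, dist_comm s₁, dist_eq_norm, Real.dist_eq, abs_of_nonneg (sub_nonneg.2 h)]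
      exact hlip s₁ h₁ s₂ h₂ h
    · rw [dist_eq_norm, Real.dist_eq, abs_of_nonneg (sub_nonneg.2 h)]
      exact hlip s₂ h₂ s₁ h₁ h
  refine ⟨T, hT0, y, ?_, fun s hs => (hy s hs).1, ⟨_, hLip⟩, ?_,
    fun s hs => ⟨fun n => t n s, hgood.mono fun n hn => (hn.2.2 s hs).1, (hy s hs).2⟩⟩
  · refine tendsto_nhds_unique (hy 0 h0T).2 (hx₀.congr' ?_)
    filter_upwards [hgood, hab] with n hn hab
    have := hn.1.norm_sub_le hc.le (fun t ht => hf _ (hn.2.1 ht)) (left_mem_Icc.2 hab)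
      (hn.2.2 0 h0T).1 (hn.2.2 0 h0T).1.1
    rw [(hn.2.2 0 h0T).2, add_zero, sub_self] at this
    have := nonpos_of_mul_nonpos_right this hc
    rw [norm_le_zero_iff, sub_eq_zero] at this
    exact this.symm
  · have h1 := hLip.ae_differentiableWithinAt_real measurableSet_Icc
    have h2 : ∀ᵐ s ∂(volume.restrict (Icc 0 T)), s ∈ Ioo 0 T := by
      rw [← restrict_Ioo_eq_restrict_Icc]
      exact ae_restrict_mem measurableSet_Ioo
    filter_upwards [h1, h2] with s hd hs
    have hsI := Ioo_subset_Icc_self hs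
    have hd' := (hd.differentiableAt (Icc_mem_nhds hs.1 hs.2)).hasDerivAt
    refine ⟨deriv y s, ?_, ?_, hd'⟩
    -- a functional positive on `G (y s)` is non-negative on the cones near `y s`, hence does not
    -- decrease along the approximating curves for short times after `s`
    · refine hG.mem_of_forall_pos (hy s hsI).1 hc (hf _ (hy s hsI).1) fun g hg => ?_
      have hev := hG.eventually_nonneg hB g.continuous (fun r _ w => by simp) hg
      obtain ⟨ε, hε, hball⟩ := Metric.eventually_nhds_iff.1 hev
      have hder : HasDerivAt (fun s => g (y s)) (g (deriv y s)) s :=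
        g.hasFDerivAt.comp_hasDerivAt s hd'
      have hslope := (hasDerivAt_iff_tendsto_slope.1 hder).mono_left
        (nhdsWithin_mono s (fun r (hr : r ∈ Ioi s) => ne_of_gt hr))
      refine ge_of_tendsto hslope ?_
      have hlt : s < min T (s + c * (ε / 2)) := lt_min hs.2 (by
        have := mul_pos hc (half_pos hε)
        linarith)
      filter_upwards [Ioo_mem_nhdsGT hlt] with r hr
      have hrT : r ∈ Icc 0 T := ⟨hs.1.le.trans hr.1.le, hr.2.le.trans (min_le_left _ _)⟩
      rw [slope_def_field]
      refine div_nonneg (sub_nonneg.2 ?_) (sub_nonneg.2 hr.1.le)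
      refine le_of_tendsto_of_tendsto ((g.continuous.tendsto _).comp (hy s hsI).2)
        ((g.continuous.tendsto _).comp (hy r hrT).2) ?_
      filter_upwards [hgood, htmono,
        (hy s hsI).2.eventually (Metric.ball_mem_nhds _ (half_pos hε))] with n hn hm hnear
      refine hn.1.le_of_nonneg _ (hn.2.2 s hsI).1 _ (hn.2.2 r hrT).1 (hm s hsI r hrT hr.1) g
        fun τ hτ => ?_
      have hτI : τ ∈ Icc (a n) (b n) :=
        ⟨(hn.2.2 s hsI).1.1.trans hτ.1, hτ.2.trans (hn.2.2 r hrT).1.2⟩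
      refine hball ?_ (hn.2.1 hτI)
      have e1 := hn.1.norm_sub_le hc.le (fun t ht => hf _ (hn.2.1 ht)) (hn.2.2 s hsI).1 hτI hτ.1
      have e2 := hn.1.norm_sub_le hc.le (fun t ht => hf _ (hn.2.1 ht)) hτI (hn.2.2 r hrT).1 hτ.2
      have e3 := mul_nonneg hc.le (norm_nonneg (x n (t n r) - x n τ))
      rw [(hn.2.2 s hsI).2] at e1
      rw [(hn.2.2 r hrT).2] at e2
      have e4 : c * ‖x n τ - x n (t n s)‖ < c * (ε / 2) := by
        have := hr.2.trans_le (min_le_right _ _)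
        linarith
      have e5 := lt_of_mul_lt_mul_left e4 hc.le
      calc dist (x n τ) (y s) ≤ dist (x n τ) (x n (t n s)) + dist (x n (t n s)) (y s) :=
            dist_triangle _ _ _
        _ < ε / 2 + ε / 2 := add_lt_add (by rwa [dist_eq_norm]) hnear
        _ = ε := add_halves ε
    -- in the chosen parametrization `f` grows at unit speed, so the velocity is not zero
    · intro h0
      rw [h0] at hd'
      have h3 : HasDerivAt (fun s => f (y s)) (f 0) s := f.hasFDerivAt.comp_hasDerivAt s hd'
      have h4 : HasDerivAt (fun s => f (y s)) 1 s := by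
        refine ((hasDerivAt_id s).const_add (f x₀)).congr_of_eventuallyEq ?_
        filter_upwards [Icc_mem_nhds hs.1 hs.2] with r hr
        exact hfy r hr
      have := h3.unique h4
      simp at this

end VectorSpace

/-! ### Lipschitz functions and exit times -/

section Lipschitz

variable {X : Type*} [PseudoMetricSpace X]

theorem LipschitzOnWith.congr_of_eqOn {f g : ℝ → X} {s : Set ℝ} {K : ℝ≥0}
    (hf : LipschitzOnWith K f s) (h : EqOn g f s) : LipschitzOnWith K g s := fun x hx y hy => by
  rw [h hx, h hy]
  exact hf hx hy

theorem LipschitzOnWith.union_of_le {f : ℝ → X} {s t : Set ℝ} {b : ℝ} {K L : ℝ≥0}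
    (hs : LipschitzOnWith K f s) (ht : LipschitzOnWith L f t) (hbs : b ∈ s) (hbt : b ∈ t)
    (hsb : ∀ x ∈ s, x ≤ b) (htb : ∀ x ∈ t, b ≤ x) : LipschitzOnWith (max K L) f (s ∪ t) := by
  have hKL : (K : ℝ) ≤ (max K L : ℝ≥0) := by exact_mod_cast le_max_left K L
  have hLK : (L : ℝ) ≤ (max K L : ℝ≥0) := by exact_mod_cast le_max_right K L
  have key : ∀ x ∈ s, ∀ y ∈ t, dist (f x) (f y) ≤ (max K L : ℝ≥0) * dist x y := by
    intro x hx y hy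
    have h1 := hs.dist_le_mul x hx b hbs
    have h2 := ht.dist_le_mul b hbt y hy
    have h3 : dist x y = dist x b + dist b y := by
      rw [Real.dist_eq, Real.dist_eq, Real.dist_eq, abs_of_nonpos, abs_of_nonpos, abs_of_nonpos] <;>
        linarith [hsb x hx, htb y hy]
    rw [h3, mul_add]
    exact (dist_triangle _ _ _).trans (add_le_add
      (h1.trans (mul_le_mul_of_nonneg_right hKL dist_nonneg))
      (h2.trans (mul_le_mul_of_nonneg_right hLK dist_nonneg)))
  refine LipschitzOnWith.of_dist_le_mul ?_
  rintro x (hx | hx) y (hy | hy)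
  · exact (hs.dist_le_mul x hx y hy).trans (mul_le_mul_of_nonneg_right hKL dist_nonneg)
  · exact key x hx y hy
  · rw [dist_comm, dist_comm x]
    exact key y hy x hx
  · exact (ht.dist_le_mul x hx y hy).trans (mul_le_mul_of_nonneg_right hLK dist_nonneg)

theorem LipschitzOnWith.le_of_ae_hasDerivAt_nonneg {h : ℝ → ℝ} {K : ℝ≥0} {a b : ℝ} (hab : a ≤ b)
    (hh : LipschitzOnWith K h (Icc a b))
    (hd : ∀ᵐ t ∂(volume.restrict (Icc a b)), ∃ v, 0 ≤ v ∧ HasDerivAt h v t) : h a ≤ h b := by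
  have h1 := (LipschitzOnWith.absolutelyContinuousOnInterval
    (by rwa [uIcc_of_le hab]) : AbsolutelyContinuousOnInterval h a b).integral_deriv_eq_sub
  have h2 : 0 ≤ ∫ t in a..b, deriv h t := by
    refine intervalIntegral.integral_nonneg_of_ae_restrict hab ?_
    filter_upwards [hd] with t ⟨v, hv, hvt⟩
    rwa [hvt.deriv]
  linarith

end Lipschitz

/-- A path from the interior of a closed set `V` to its complement stays in `V` up to some time `d`
at which it is not in the interior of `V`. -/
theorem ContinuousOn.exists_first_exit {X : Type*} [TopologicalSpace X] {γ : ℝ → X} {a b : ℝ}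
    (hγ : ContinuousOn γ (Icc a b)) (hab : a ≤ b) {V : Set X} (hV : IsClosed V)
    (ha : γ a ∈ interior V) (hb : γ b ∉ V) :
    ∃ d ∈ Icc a b, MapsTo γ (Icc a d) V ∧ γ d ∉ interior V := by
  have hS : IsClosed (Icc a b ∩ γ ⁻¹' (interior V)ᶜ) :=
    hγ.preimage_isClosed_of_isClosed isClosed_Icc isOpen_interior.isClosed_compl
  have hSc : IsCompact (Icc a b ∩ γ ⁻¹' (interior V)ᶜ) :=
    isCompact_Icc.of_isClosed_subset hS inter_subset_left
  obtain ⟨d, ⟨hd, hdV⟩, hmin⟩ := hSc.exists_isLeast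
    ⟨b, right_mem_Icc.2 hab, fun h => hb (interior_subset h)⟩
  have had : a ≠ d := by
    rintro rfl
    exact hdV ha
  refine ⟨d, hd, ?_, hdV⟩
  have hmaps : MapsTo γ (Ico a d) V := by
    intro t ht
    by_contra h
    exact absurd (hmin ⟨⟨ht.1, ht.2.le.trans hd.2⟩, fun h' => h (interior_subset h')⟩)
      (not_le.2 ht.2)
  have := hmaps.closure_of_continuousOn (by
    rw [closure_Ico had]
    exact hγ.mono (Icc_subset_Icc_right hd.2))
  rwa [closure_Ico had, hV.closure_eq] at this

/-! ### Locally Lipschitz curves on manifolds -/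

section Curves

variable {n : ℕ} {M : Type*} [TopologicalSpace M] [ChartedSpace (EuclideanSpace ℝ (Fin n)) M]

local notation "E" => EuclideanSpace ℝ (Fin n)

/-- Being Lipschitz near `t` does not depend on the chart, as transition maps are `C¹`. -/
theorem lipschitzOnWith_chart_change [IsManifold (𝓡 n) 1 M] {γ : ℝ → M} {S : Set ℝ} {t : ℝ}
    (hγ : ContinuousWithinAt γ S t)
    {p q : M} (hp : γ t ∈ (chartAt E p).source) (hq : γ t ∈ (chartAt E q).source)
    (h : ∃ K : ℝ≥0, ∃ s ∈ 𝓝[S] t, LipschitzOnWith K (chartAt E p ∘ γ) s) :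
    ∃ K : ℝ≥0, ∃ s ∈ 𝓝[S] t, MapsTo γ s (chartAt E q).source ∧
      LipschitzOnWith K (chartAt E q ∘ γ) s := by
  obtain ⟨K, s, hs, hK⟩ := h
  have hcd : ContDiffAt ℝ 1 (chartAt E q ∘ (chartAt E p).symm) (chartAt E p (γ t)) := by
    have := contDiffWithinAt_ext_coord_change (I := 𝓡 n) (n := 1) q p (y := chartAt E p (γ t))
      (by simp [hp, hq])
    simpa [contDiffWithinAt_univ] using this
  obtain ⟨L, u, hu, hL⟩ := hcd.exists_lipschitzOnWith
  have hc : ContinuousWithinAt (chartAt E p ∘ γ) S t :=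
    ((chartAt E p).continuousAt hp).comp_continuousWithinAt hγ
  have hps := hγ.preimage_mem_nhdsWithin ((chartAt E p).open_source.mem_nhds hp)
  have hqs := hγ.preimage_mem_nhdsWithin ((chartAt E q).open_source.mem_nhds hq)
  have hus := hc.preimage_mem_nhdsWithin hu
  refine ⟨L * K, s ∩ (γ ⁻¹' (chartAt E p).source ∩ (γ ⁻¹' (chartAt E q).source ∩
    (chartAt E p ∘ γ) ⁻¹' u)), inter_mem hs (inter_mem hps (inter_mem hqs hus)),
    fun r hr => hr.2.2.1, ?_⟩
  refine (hL.comp (hK.mono inter_subset_left) (fun r hr => hr.2.2.2)).congr_of_eqOn ?_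
  intro r hr
  simp [(chartAt E p).left_inv hr.2.1]

namespace LocLipschitzCurve

variable {γ γ' : ℝ → M} {a b c d : ℝ}

theorem mono (h : LocLipschitzCurve n γ a b) (hs : Icc c d ⊆ Icc a b) :
    LocLipschitzCurve n γ c d := by
  refine ⟨h.1.mono hs, fun t ht => ?_⟩
  obtain ⟨K, s, hs', h1, h2⟩ := h.2 t (hs ht)
  exact ⟨K, s, nhdsWithin_mono t hs hs', h1, h2⟩

theorem congr (h : LocLipschitzCurve n γ a b) (hγ : EqOn γ' γ (Icc a b)) :
    LocLipschitzCurve n γ' a b := by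
  refine ⟨h.1.congr hγ, fun t ht => ?_⟩
  obtain ⟨K, s, hs', h1, h2⟩ := h.2 t ht
  have hsub : s ∩ Icc a b ∈ 𝓝[Icc a b] t := inter_mem hs' self_mem_nhdsWithin
  rw [hγ ht]
  refine ⟨K, _, hsub, fun r hr => ?_, (h2.mono inter_subset_left).congr_of_eqOn fun r hr => ?_⟩
  · rw [hγ hr.2]
    exact h1 hr.1
  · simp [hγ hr.2]

theorem comp_add_const (h : LocLipschitzCurve n γ a b) (k : ℝ) :
    LocLipschitzCurve n (fun t => γ (t + k)) (a - k) (b - k) := by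
  have hm : MapsTo (fun t : ℝ => t + k) (Icc (a - k) (b - k)) (Icc a b) := fun t ht =>
    ⟨by linarith [ht.1], by linarith [ht.2]⟩
  refine ⟨h.1.comp (by fun_prop) hm, fun t ht => ?_⟩
  obtain ⟨K, s, hs', h1, h2⟩ := h.2 (t + k) (hm ht)
  refine ⟨K, (fun t => t + k) ⁻¹' s, ?_, fun r hr => h1 hr, ?_⟩
  · exact (Continuous.continuousWithinAt (by fun_prop)).tendsto_nhdsWithin hm hs'
  · have : LipschitzOnWith 1 (fun t : ℝ => t + k) ((fun t => t + k) ⁻¹' s) :=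
      (LipschitzWith.of_dist_le_mul fun x y => by simp).lipschitzOnWith
    simpa [Function.comp_def] using h2.comp this (fun r hr => hr)

theorem append (h : LocLipschitzCurve n γ a b) (h' : LocLipschitzCurve n γ b c) (hab : a ≤ b)
    (hbc : b ≤ c) : LocLipschitzCurve n γ a c := by
  have hU := Icc_union_Icc_eq_Icc hab hbc
  refine ⟨hU ▸ h.1.union_of_isClosed h'.1 isClosed_Icc isClosed_Icc, fun t ht => ?_⟩
  rcases lt_trichotomy t b with htb | rfl | htb
  · obtain ⟨K, s, hs, h1, h2⟩ := h.2 t ⟨ht.1, htb.le⟩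
    refine ⟨K, s, ?_, h1, h2⟩
    rw [← hU, nhdsWithin_union]
    refine ⟨hs, ?_⟩
    rw [notMem_closure_iff_nhdsWithin_eq_bot.1 (by
      rw [closure_Icc]
      exact fun h => absurd h.1 (not_le.2 htb))]
    trivial
  · obtain ⟨K, s, hs, h1, h2⟩ := h.2 t (right_mem_Icc.2 hab)
    obtain ⟨K', s', hs', h1', h2'⟩ := h'.2 t (left_mem_Icc.2 hbc)
    have hms := inter_mem hs self_mem_nhdsWithin
    have hms' := inter_mem hs' self_mem_nhdsWithin
    refine ⟨max K K', (s ∩ Icc a t) ∪ (s' ∩ Icc t c), ?_, ?_, ?_⟩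
    · rw [← hU, nhdsWithin_union]
      exact ⟨mem_of_superset hms subset_union_left, mem_of_superset hms' subset_union_right⟩
    · rintro r (hr | hr)
      · exact h1 hr.1
      · exact h1' hr.1
    · exact (h2.mono inter_subset_left).union_of_le (h2'.mono inter_subset_left)
        (mem_of_mem_nhdsWithin (right_mem_Icc.2 hab) hms)
        (mem_of_mem_nhdsWithin (left_mem_Icc.2 hbc) hms') (fun x hx => hx.2.2) (fun x hx => hx.2.1)
  · obtain ⟨K, s, hs, h1, h2⟩ := h'.2 t ⟨htb.le, ht.2⟩
    refine ⟨K, s, ?_, h1, h2⟩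
    rw [← hU, nhdsWithin_union]
    refine ⟨?_, hs⟩
    rw [notMem_closure_iff_nhdsWithin_eq_bot.1 (by
      rw [closure_Icc]
      exact fun h => absurd h.2 (not_le.2 htb))]
    trivial

theorem exists_lipschitzOnWith_chart [IsManifold (𝓡 n) 1 M] (h : LocLipschitzCurve n γ a b) {p : M}
    (hp : MapsTo γ (Icc a b) (chartAt E p).source) :
    ∃ K, LipschitzOnWith K (chartAt E p ∘ γ) (Icc a b) := by
  refine LocallyLipschitzOn.exists_lipschitzOnWith_of_compact isCompact_Icc fun t ht => ?_
  obtain ⟨K, s, hs, -, h2⟩ := h.2 t ht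
  obtain ⟨K', s', hs', -, h'⟩ := lipschitzOnWith_chart_change (h.1 t ht)
    (mem_chart_source E (γ t)) (hp ht) ⟨K, s, hs, h2⟩
  exact ⟨K', s', hs', h'⟩

end LocLipschitzCurve

/-- Curves from points tending to `p` to points tending to `q ≠ p`, which follow the cone field `G`
as long as they stay in the chart at `p`, accumulate near `p` on a Lipschitz curve with velocity in the
cones, whose endpoint is again a limit of points of the curves. The field `G` is left arbitrary so
that it can be the cone field of a closed cone structure or its opposite. -/
theorem FollowsCones.exists_limit_in_chart [T2Space M] {ι : Type*} (𝒰 : Ultrafilter ι)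
    {p q : M} (hpq : p ≠ q) {G : E → Set E}
    (hG : ∀ B : Set E, IsClosed B → B ⊆ (chartAt E p).target → IsClosedConeField G B)
    (hGs : ∀ y, ∀ w ∈ G y, -w ∈ G y → w = 0)
    {γ : ι → ℝ → M} {a b : ι → ℝ} (hab : ∀ i, a i ≤ b i)
    (hγ : ∀ i, ContinuousOn (γ i) (Icc (a i) (b i)))
    (hfol : ∀ i, ∀ d ∈ Icc (a i) (b i), MapsTo (γ i) (Icc (a i) d) (chartAt E p).source →
      FollowsCones G (chartAt E p ∘ γ i) (a i) d)
    (ha : Tendsto (fun i => γ i (a i)) 𝒰 (𝓝 p)) (hb : Tendsto (fun i => γ i (b i)) 𝒰 (𝓝 q)) :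
    ∃ T : ℝ, 0 < T ∧ ∃ y : ℝ → E, y 0 = chartAt E p p ∧
      MapsTo y (Icc 0 T) (chartAt E p).target ∧
      (∃ K : ℝ≥0, LipschitzOnWith K y (Icc 0 T)) ∧
      (∀ᵐ s ∂(volume.restrict (Icc 0 T)), ∃ w ∈ G (y s), w ≠ 0 ∧ HasDerivAt y w s) ∧
      ∃ t : ι → ℝ, (∀ᶠ i in 𝒰, t i ∈ Icc (a i) (b i)) ∧
        Tendsto (fun i => γ i (t i)) 𝒰 (𝓝 ((chartAt E p).symm (y T))) := by
  set φ := chartAt E p with hφ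
  have hp := mem_chart_source E p
  have hpt := mem_chart_target E p
  have hinv : φ.symm (φ p) = p := φ.left_inv hp
  -- a closed ball of the chart on which some functional dominates the norm on the cones
  obtain ⟨R₀, hR₀, hR₀t⟩ := Metric.nhds_basis_closedBall.mem_iff.1 (φ.open_target.mem_nhds hpt)
  have hG₀ := hG _ Metric.isClosed_closedBall hR₀t
  have hmem₀ := Metric.mem_closedBall_self (x := φ p) hR₀.le
  obtain ⟨f, hf⟩ := hG₀.exists_pos_functional hmem₀ (hGs _)
  obtain ⟨c, hc, hev⟩ := hG₀.exists_eventually_norm_le (isCompact_closedBall _ _) hmem₀ f hf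
  have hne : ∀ᶠ z in 𝓝 (φ p), φ.symm z ≠ q :=
    (φ.continuousAt_symm hpt).eventually_ne (by rwa [hinv])
  obtain ⟨R, hR, hRs⟩ := Metric.nhds_basis_closedBall.mem_iff.1
    (inter_mem (inter_mem hev hne) (Metric.closedBall_mem_nhds (φ p) hR₀))
  set B := Metric.closedBall (φ p) R with hBdef
  have hBt : B ⊆ φ.target := fun z hz => hR₀t (hRs hz).2
  have hfB : ∀ z ∈ B, ∀ w ∈ G z, c * ‖w‖ ≤ f w := fun z hz => (hRs hz).1.1 (hRs hz).2
  have hB : IsCompact B := isCompact_closedBall _ _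
  set V := φ.symm '' B with hV
  have hVc : IsClosed V := (hB.image_of_continuousOn (φ.continuousOn_symm.mono hBt)).isClosed
  have hVs : V ⊆ φ.source := by
    rintro _ ⟨z, hz, rfl⟩
    exact φ.map_target (hBt hz)
  have hVB : MapsTo φ V B := by
    rintro _ ⟨z, hz, rfl⟩
    rwa [φ.right_inv (hBt hz)]
  have hqV : q ∉ V := by
    rintro ⟨z, hz, hzq⟩
    exact (hRs hz).1.2 hzq
  have hVi : φ.source ∩ φ ⁻¹' Metric.ball (φ p) R ⊆ interior V := by
    refine interior_maximal ?_ (φ.isOpen_inter_preimage Metric.isOpen_ball)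
    rintro z ⟨hz, hzR⟩
    exact ⟨φ z, Metric.ball_subset_closedBall hzR, φ.left_inv hz⟩
  have hφa : Tendsto (fun i => φ (γ i (a i))) 𝒰 (𝓝 (φ p)) := (φ.continuousAt hp).tendsto.comp ha
  -- the first times at which the curves leave the ball
  have hex : ∀ᶠ i in 𝒰, ∃ d ∈ Icc (a i) (b i), MapsTo (γ i) (Icc (a i) d) V ∧
      R / 2 ≤ ‖φ (γ i d) - φ (γ i (a i))‖ := by
    filter_upwards [ha.eventually (φ.open_source.mem_nhds hp),
      hφa.eventually (Metric.ball_mem_nhds _ (half_pos hR)),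
      hb.eventually (hVc.isOpen_compl.mem_nhds hqV)] with i h1 h2 h3
    obtain ⟨d, hd, hdV, hdi⟩ := (hγ i).exists_first_exit (hab i) hVc
      (hVi ⟨h1, Metric.ball_subset_ball (half_le_self hR.le) h2⟩) h3
    refine ⟨d, hd, hdV, ?_⟩
    by_contra! hlt
    refine hdi (hVi ⟨hVs (hdV (right_mem_Icc.2 hd.1)), ?_⟩)
    have h4 := dist_triangle (φ (γ i d)) (φ (γ i (a i))) (φ p)
    rw [dist_eq_norm (φ (γ i d)) (φ (γ i (a i)))] at h4
    have h5 : dist (φ (γ i (a i))) (φ p) < R / 2 := h2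
    change dist (φ (γ i d)) (φ p) < R
    linarith
  have hex' : ∀ i, ∃ d, (∃ d ∈ Icc (a i) (b i), MapsTo (γ i) (Icc (a i) d) V ∧
      R / 2 ≤ ‖φ (γ i d) - φ (γ i (a i))‖) → d ∈ Icc (a i) (b i) ∧
      MapsTo (γ i) (Icc (a i) d) V ∧ R / 2 ≤ ‖φ (γ i d) - φ (γ i (a i))‖ := by
    intro i
    by_cases h : ∃ d ∈ Icc (a i) (b i), MapsTo (γ i) (Icc (a i) d) V ∧
      R / 2 ≤ ‖φ (γ i d) - φ (γ i (a i))‖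
    · obtain ⟨d, hd⟩ := h
      exact ⟨d, fun _ => hd⟩
    · exact ⟨0, fun h' => absurd h' h⟩
  choose d hd using hex'
  replace hd := hex.mono hd
  obtain ⟨T, hT, y, hy0, hyB, hyL, hyd, hyt⟩ := FollowsCones.exists_limit
    (hG B Metric.isClosed_closedBall hBt) hB hc hfB 𝒰 (x := fun i => φ ∘ γ i) (a := a) (b := d)
    (hd.mono fun i hi => hi.1.1) (hd.mono fun i hi => hfol i _ hi.1 (hi.2.1.mono_right hVs))
    (hd.mono fun i hi => hVB.comp hi.2.1) hφa (half_pos hR) (hd.mono fun i hi => hi.2.2)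
  have hTT : T ∈ Icc 0 T := right_mem_Icc.2 hT.le
  obtain ⟨t, ht, htt⟩ := hyt T hTT
  refine ⟨T, hT, y, hy0, hyB.mono_right hBt, hyL, hyd, t, ?_, ?_⟩
  · filter_upwards [ht, hd] with i h1 h2
    exact ⟨h1.1, h1.2.trans h2.1.2⟩
  · refine ((φ.continuousAt_symm (hBt (hyB hTT))).tendsto.comp htt).congr' ?_
    filter_upwards [ht, hd] with i h1 h2
    exact φ.left_inv (hVs (h2.2.1 h1))

end Curves

/-! ### Closed cone structures in charts -/

namespace ClosedConeStructure

variable {n : ℕ} {M : Type*} [TopologicalSpace M] [ChartedSpace (EuclideanSpace ℝ (Fin n)) M]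
  [IsManifold (𝓡 n) 1 M]

local notation "E" => EuclideanSpace ℝ (Fin n)

/-- The cones of `C` read in the chart at `p`, with the origin added. Tangent vectors are moved by
the trivialization of the tangent bundle at `p`, i.e. by the derivative of the chart. -/
def chartCone (C : ClosedConeStructure n M) (p : M) (y : E) : Set E :=
  {w | w = 0 ∨ (trivializationAt E (TangentSpace (𝓡 n)) p).symmL ℝ ((chartAt E p).symm y) w ∈
    C.cone ((chartAt E p).symm y)}

theorem eq_zero_of_neg_mem_chartCone (C : ClosedConeStructure n M) (p : M) (y : E) {w : E}
    (hw : w ∈ C.chartCone p y) (hw' : -w ∈ C.chartCone p y) : w = 0 := by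
  rcases hw with hw | hw
  · exact hw
  rcases hw' with hw' | hw'
  · simpa using hw'
  · rw [map_neg] at hw'
    exact absurd hw' (C.sharp _ _ hw)

theorem isClosedConeField_chartCone (C : ClosedConeStructure n M) (p : M) {B : Set E}
    (hB : IsClosed B) (hBp : B ⊆ (chartAt E p).target) :
    IsClosedConeField (C.chartCone p) B where
  zero_mem y _ := Or.inl rfl
  smul_mem y _ s hs w hw := by
    rcases hw with rfl | hw
    · exact Or.inl (smul_zero s)
    · right
      rw [map_smul]
      exact C.smul_mem _ s _ hs hw
  convex y _ := by
    rw [convex_iff_forall_pos]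
    rintro v hv w hw a b ha hb hab
    rcases hv with rfl | hv
    · rcases hw with rfl | hw
      · left
        simp
      · right
        rw [smul_zero, zero_add, map_smul]
        exact C.smul_mem _ b _ hb hw
    · right
      rcases hw with rfl | hw
      · rw [smul_zero, add_zero, map_smul]
        exact C.smul_mem _ a _ ha hv
      · rw [map_add, map_smul, map_smul]
        exact C.convex _ hv hw ha.le hb.le hab
  isClosed := by
    obtain ⟨D, hD, hDC⟩ := isClosed_induced_iff.1 C.isClosed_total
    set e := trivializationAt E (TangentSpace (𝓡 n)) p with he
    -- the inverse of the chart of the tangent bundle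
    let Ψ : E × E → TangentBundle (𝓡 n) M := fun z =>
      e.toOpenPartialHomeomorph.symm ((chartAt E p).symm z.1, z.2)
    have hsrc : ∀ z ∈ B ×ˢ (univ : Set E), (chartAt E p).symm z.1 ∈ e.baseSet := fun z hz => by
      rw [he, TangentBundle.trivializationAt_baseSet]
      exact (chartAt E p).map_target (hBp hz.1)
    have hΨ : ContinuousOn Ψ (B ×ˢ univ) := by
      refine e.toOpenPartialHomeomorph.continuousOn_symm.comp (((chartAt E p).continuousOn_symm.comp
        continuousOn_fst fun z hz => hBp hz.1).prodMk continuousOn_snd) fun z hz => ?_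
      exact e.mem_target.2 (hsrc z hz)
    have hΨeq : ∀ z ∈ B ×ˢ (univ : Set E), Ψ z =
        ⟨(chartAt E p).symm z.1, e.symmL ℝ ((chartAt E p).symm z.1) z.2⟩ := fun z hz => by
      rw [e.symmL_apply (R := ℝ) (hsrc z hz)]
      exact (e.mk_symm (hsrc z hz) z.2).symm
    have h1 : IsClosed (B ×ˢ (univ : Set E) ∩ Ψ ⁻¹' D) :=
      hΨ.preimage_isClosed_of_isClosed (hB.prod isClosed_univ) hD
    have h2 : IsClosed (B ×ˢ ({0} : Set E)) := hB.prod isClosed_singleton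
    convert h1.union h2 using 1
    ext ⟨y, w⟩
    by_cases hy : y ∈ B
    swap
    · simp [hy]
    by_cases hw : w = 0
    · simp [hy, hw, chartCone]
    have hz : (y, w) ∈ B ×ˢ (univ : Set E) := ⟨hy, trivial⟩
    have hne : e.symmL ℝ ((chartAt E p).symm y) w ≠ 0 := fun h => hw (by
      rw [← e.continuousLinearMapAt_symmL (R := ℝ) (hsrc _ hz) w, h, map_zero])
    have := Set.ext_iff.1 hDC ⟨⟨(chartAt E p).symm y, e.symmL ℝ ((chartAt E p).symm y) w⟩, hne⟩
    simp only [mem_preimage, mem_ofPred_eq] at this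
    simp only [chartCone, hw, hy, mem_ofPred_eq, mem_union, mem_inter_iff, mem_prod, mem_univ,
      mem_preimage, mem_singleton_iff, false_or, and_false, or_false, true_and, and_true]
    rw [hΨeq _ hz, this]

/-- The velocity of `γ` at time `t` exists and belongs to the cone at `γ t`. -/
def HasCausalVelocityAt (C : ClosedConeStructure n M) (γ : ℝ → M) (t : ℝ) : Prop :=
  MDifferentiableAt 𝓘(ℝ, ℝ) (𝓡 n) γ t ∧ mfderiv 𝓘(ℝ, ℝ) (𝓡 n) γ t (1 : ℝ) ∈ C.cone (γ t)

/-- The velocity condition read in any chart around `γ t`. -/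
theorem hasCausalVelocityAt_iff (C : ClosedConeStructure n M) {γ : ℝ → M} {t : ℝ} {p : M}
    (hp : γ t ∈ (chartAt E p).source) :
    C.HasCausalVelocityAt γ t ↔ ContinuousAt γ t ∧
      ∃ w ∈ C.chartCone p (chartAt E p (γ t)), w ≠ 0 ∧ HasDerivAt (chartAt E p ∘ γ) w t := by
  set e := trivializationAt E (TangentSpace (𝓡 n)) p with he
  have hbase : γ t ∈ e.baseSet := by
    rwa [he, TangentBundle.trivializationAt_baseSet]
  have hinv := (chartAt E p).left_inv hp
  have key : MDifferentiableAt 𝓘(ℝ, ℝ) (𝓡 n) γ t → HasDerivAt (chartAt E p ∘ γ)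
      (e.continuousLinearMapAt ℝ (γ t) (mfderiv 𝓘(ℝ, ℝ) (𝓡 n) γ t (1 : ℝ))) t := by
    intro h
    have h1 := (mdifferentiableAt_extChartAt (I := 𝓡 n) hp).hasMFDerivAt
    rw [← TangentBundle.continuousLinearMapAt_trivializationAt hp] at h1
    have h2 : HasFDerivAt (chartAt E p ∘ γ) ((e.continuousLinearMapAt ℝ (γ t)).comp
        (mfderiv 𝓘(ℝ, ℝ) (𝓡 n) γ t) : ℝ →L[ℝ] E) t := (h1.comp t h.hasMFDerivAt).hasFDerivAt
    exact h2.hasDerivAt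
  have hmem : ∀ w : E, w ≠ 0 → (w ∈ C.chartCone p (chartAt E p (γ t)) ↔
      e.symmL ℝ (γ t) w ∈ C.cone (γ t)) := by
    intro w hw
    simp only [chartCone, hw, mem_ofPred_eq, false_or]
    rw [hinv]
  constructor
  · rintro ⟨hd, hv⟩
    have hs := e.symmL_continuousLinearMapAt (R := ℝ) hbase (mfderiv 𝓘(ℝ, ℝ) (𝓡 n) γ t (1 : ℝ))
    have hne : e.continuousLinearMapAt ℝ (γ t) (mfderiv 𝓘(ℝ, ℝ) (𝓡 n) γ t (1 : ℝ)) ≠ 0 := by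
      intro h0
      rw [h0, map_zero] at hs
      rw [← hs] at hv
      exact C.zero_notMem _ hv
    refine ⟨hd.continuousAt, _, (hmem _ hne).2 ?_, hne, key hd⟩
    rwa [hs]
  · rintro ⟨hc, w, hw, hw0, hd⟩
    have hmd : MDifferentiableAt 𝓘(ℝ, ℝ) (𝓡 n) γ t := by
      have h1 : MDifferentiableAt (𝓡 n) (𝓡 n) (chartAt E p).symm ((chartAt E p ∘ γ) t) :=
        mdifferentiableAt_atlas_symm (chart_mem_atlas _ p) ((chartAt E p).map_source hp)
      have h2 := h1.comp t hd.differentiableAt.mdifferentiableAt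
      refine h2.congr_of_eventuallyEq ?_
      filter_upwards [hc.preimage_mem_nhds ((chartAt E p).open_source.mem_nhds hp)] with r hr
      exact ((chartAt E p).left_inv hr).symm
    refine ⟨hmd, ?_⟩
    have := (key hmd).unique hd
    rw [hmem w hw0, ← this, e.symmL_continuousLinearMapAt (R := ℝ) hbase] at hw
    exact hw

/-! ### Causal curves -/

theorem HasCausalVelocityAt.congr {C : ClosedConeStructure n M} {γ γ' : ℝ → M} {t : ℝ}
    (h : C.HasCausalVelocityAt γ t) (hγ : γ' =ᶠ[𝓝 t] γ) : C.HasCausalVelocityAt γ' t := by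
  have hp := mem_chart_source E (γ t)
  obtain ⟨hc, w, hw, hw0, hd⟩ := (C.hasCausalVelocityAt_iff hp).1 h
  rw [← hγ.eq_of_nhds] at hp hw
  refine (C.hasCausalVelocityAt_iff hp).2 ⟨hc.congr hγ.symm, w, ?_, hw0, ?_⟩
  · exact hw
  · exact hd.congr_of_eventuallyEq (by
      filter_upwards [hγ] with r hr
      rw [Function.comp_apply, Function.comp_apply, hr, hγ.eq_of_nhds])

theorem HasCausalVelocityAt.comp_add_const {C : ClosedConeStructure n M} {γ : ℝ → M} {t k : ℝ}
    (h : C.HasCausalVelocityAt γ (t + k)) : C.HasCausalVelocityAt (fun s => γ (s + k)) t := by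
  have hp := mem_chart_source E (γ (t + k))
  obtain ⟨hc, w, hw, hw0, hd⟩ := (C.hasCausalVelocityAt_iff hp).1 h
  refine (C.hasCausalVelocityAt_iff (γ := fun s => γ (s + k)) hp).2
    ⟨ContinuousAt.comp (f := fun s => s + k) hc (by fun_prop), w, hw, hw0, ?_⟩
  exact HasDerivAt.comp_add_const t k hd

namespace IsCausalCurve

variable {C : ClosedConeStructure n M} {γ γ' : ℝ → M} {a b c d : ℝ}

theorem mono (h : C.IsCausalCurve γ a b) (hcd : c < d) (hs : Icc c d ⊆ Icc a b) :
    C.IsCausalCurve γ c d :=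
  ⟨hcd, h.2.1.mono hs, ae_restrict_of_ae_restrict_of_subset hs h.2.2⟩

theorem congr (h : C.IsCausalCurve γ a b) (hγ : EqOn γ' γ (Icc a b)) :
    C.IsCausalCurve γ' a b := by
  refine ⟨h.1, h.2.1.congr hγ, ?_⟩
  have h2 := h.2.2
  rw [← restrict_Ioo_eq_restrict_Icc] at h2 ⊢
  filter_upwards [h2, ae_restrict_mem measurableSet_Ioo] with t ht hto
  exact HasCausalVelocityAt.congr ht
    (hγ.eventuallyEq_of_mem (Icc_mem_nhds hto.1 hto.2))

theorem comp_add_const (h : C.IsCausalCurve γ a b) (k : ℝ) :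
    C.IsCausalCurve (fun t => γ (t + k)) (a - k) (b - k) := by
  refine ⟨by linarith [h.1], h.2.1.comp_add_const k, ?_⟩
  have h2 := (ae_restrict_iff' measurableSet_Icc).1 h.2.2
  rw [ae_restrict_iff' measurableSet_Icc]
  filter_upwards [(measurePreserving_add_right volume k).quasiMeasurePreserving.ae h2] with t ht hI
  exact HasCausalVelocityAt.comp_add_const (ht ⟨by linarith [hI.1], by linarith [hI.2]⟩)

theorem append (h : C.IsCausalCurve γ a b) (h' : C.IsCausalCurve γ b c) :
    C.IsCausalCurve γ a c := by
  refine ⟨h.1.trans h'.1, h.2.1.append h'.2.1 h.1.le h'.1.le, ?_⟩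
  rw [← Icc_union_Icc_eq_Icc h.1.le h'.1.le, ae_restrict_union_iff]
  exact ⟨h.2.2, h'.2.2⟩

theorem causalLE (h : C.IsCausalCurve γ a b) (hc : c ∈ Icc a b) (hd : d ∈ Icc a b) (hcd : c ≤ d) :
    C.CausalLE (γ c) (γ d) := by
  rcases hcd.eq_or_lt with rfl | hcd
  · exact Or.inr rfl
  · exact Or.inl ⟨γ, c, d, h.mono hcd (Icc_subset_Icc hc.1 hd.2), rfl, rfl⟩

/-- Read in a chart, a causal curve follows the cones in the integrated sense. -/
theorem followsCones (h : C.IsCausalCurve γ a b) {p : M} (hs : Icc c d ⊆ Icc a b)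
    (hp : MapsTo γ (Icc c d) (chartAt E p).source) :
    FollowsCones (C.chartCone p) (chartAt E p ∘ γ) c d := by
  obtain ⟨K, hK⟩ := (h.2.1.mono hs).exists_lipschitzOnWith_chart hp
  refine ⟨hK.continuousOn, fun t₁ h₁ t₂ h₂ h₁₂ g hg => ?_⟩
  have hsub : Icc t₁ t₂ ⊆ Icc c d := Icc_subset_Icc h₁.1 h₂.2
  refine LipschitzOnWith.le_of_ae_hasDerivAt_nonneg (h := fun t => g ((chartAt E p ∘ γ) t)) h₁₂
    ((g.lipschitz.lipschitzOnWith (s := univ)).comp (hK.mono hsub) (mapsTo_univ _ _)) ?_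
  filter_upwards [ae_restrict_of_ae_restrict_of_subset (hsub.trans hs) h.2.2,
    ae_restrict_mem measurableSet_Icc] with t ht htI
  obtain ⟨-, w, hw, -, hd⟩ := (C.hasCausalVelocityAt_iff (hp (hsub htI))).1 ht
  exact ⟨g w, hg t htI w hw, g.hasFDerivAt.comp_hasDerivAt t hd⟩

end IsCausalCurve

/-- A Lipschitz curve in a chart whose velocity lies in the cones almost everywhere is a causal
curve of the manifold. -/
theorem isCausalCurve_chart_symm_comp (C : ClosedConeStructure n M) {p : M} {y : ℝ → E} {a b : ℝ}
    (hab : a < b) (hy : MapsTo y (Icc a b) (chartAt E p).target)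
    (hL : ∃ K : ℝ≥0, LipschitzOnWith K y (Icc a b))
    (hd : ∀ᵐ s ∂(volume.restrict (Icc a b)),
      ∃ w ∈ C.chartCone p (y s), w ≠ 0 ∧ HasDerivAt y w s) :
    C.IsCausalCurve ((chartAt E p).symm ∘ y) a b := by
  obtain ⟨K, hK⟩ := hL
  have hc : ContinuousOn ((chartAt E p).symm ∘ y) (Icc a b) :=
    (chartAt E p).continuousOn_symm.comp hK.continuousOn hy
  have heq : EqOn (chartAt E p ∘ ((chartAt E p).symm ∘ y)) y (Icc a b) := fun t ht =>
    (chartAt E p).right_inv (hy ht)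
  refine ⟨hab, ⟨hc, fun t ht => ?_⟩, ?_⟩
  · exact lipschitzOnWith_chart_change (hc t ht) ((chartAt E p).map_target (hy ht))
      (mem_chart_source E _) ⟨K, _, self_mem_nhdsWithin, hK.congr_of_eqOn heq⟩
  · rw [← restrict_Ioo_eq_restrict_Icc] at hd ⊢
    filter_upwards [hd, ae_restrict_mem measurableSet_Ioo] with t ht hto
    obtain ⟨w, hw, hw0, hd⟩ := ht
    have hnhds := Icc_mem_nhds hto.1 hto.2
    have htI := Ioo_subset_Icc_self hto
    refine (C.hasCausalVelocityAt_iff (p := p) ((chartAt E p).map_target (hy htI))).2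
      ⟨hc.continuousAt hnhds, w, ?_, hw0, ?_⟩
    · rw [Function.comp_apply, (chartAt E p).right_inv (hy htI)]
      exact hw
    · exact hd.congr_of_eventuallyEq (heq.eventuallyEq_of_mem hnhds)

/-! ### The causal relation and limits -/

theorem CausalLT.trans {C : ClosedConeStructure n M} {p q r : M} (h : C.CausalLT p q)
    (h' : C.CausalLT q r) : C.CausalLT p r := by
  obtain ⟨γ, a, b, hγ, rfl, rfl⟩ := h
  obtain ⟨γ', c, d, hγ', hc, rfl⟩ := h'
  have h2 := hγ'.comp_add_const (c - b)
  rw [sub_sub_cancel] at h2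
  set η : ℝ → M := fun t => if t ≤ b then γ t else γ' (t + (c - b)) with hη
  have e1 : EqOn η γ (Icc a b) := fun t ht => if_pos ht.2
  have e2 : EqOn η (fun t => γ' (t + (c - b))) (Icc b (d - (c - b))) := by
    intro t ht
    rcases ht.1.eq_or_lt with rfl | hlt
    · simp [hη, hc]
    · exact if_neg (not_le.2 hlt)
  refine ⟨η, a, d - (c - b), (hγ.congr e1).append (h2.congr e2), e1 (left_mem_Icc.2 hγ.1.le), ?_⟩
  rw [e2 (right_mem_Icc.2 h2.1.le)]
  simp

theorem CausalLE.trans {C : ClosedConeStructure n M} {p q r : M} (h : C.CausalLE p q)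
    (h' : C.CausalLE q r) : C.CausalLE p r := by
  rcases h with h | rfl
  · rcases h' with h' | rfl
    · exact Or.inl (h.trans h')
    · exact Or.inl h
  · exact h'

theorem CausalLT.causalLE {C : ClosedConeStructure n M} {p q : M} (h : C.CausalLT p q) :
    C.CausalLE p q :=
  Or.inl h

theorem IsCausal.not_causalLE_of_causalLT {C : ClosedConeStructure n M} (hC : C.IsCausal)
    {p q : M} (h : C.CausalLT p q) : ¬ C.CausalLE q p := by
  rintro (h' | rfl)
  · exact hC _ (h.trans h')
  · exact hC _ h

/-- If `uᵢ < vᵢ`, `uᵢ → p` and `vᵢ → q ≠ p`, then some `p' > p` is a limit of points causally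
between `uᵢ` and `vᵢ`. -/
theorem exists_limit_future [T2Space M] (C : ClosedConeStructure n M) {ι : Type*}
    (𝒰 : Ultrafilter ι) {p q : M} (hpq : p ≠ q) {u v : ι → M} (huv : ∀ i, C.CausalLT (u i) (v i))
    (hu : Tendsto u 𝒰 (𝓝 p)) (hv : Tendsto v 𝒰 (𝓝 q)) :
    ∃ p' : M, C.CausalLT p p' ∧ ∃ r : ι → M,
      (∀ᶠ i in 𝒰, C.CausalLE (u i) (r i) ∧ C.CausalLE (r i) (v i)) ∧ Tendsto r 𝒰 (𝓝 p') := by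
  choose γ a b hγ ha hb using huv
  obtain ⟨T, hT, y, hy0, hyt, hyL, hyd, t, ht, htt⟩ := FollowsCones.exists_limit_in_chart 𝒰 hpq
    (fun B hB hBp => C.isClosedConeField_chartCone p hB hBp)
    (fun y w hw => C.eq_zero_of_neg_mem_chartCone p y hw) (fun i => (hγ i).1.le)
    (fun i => (hγ i).2.1.1) (fun i d hd hm => (hγ i).followsCones (Icc_subset_Icc_right hd.2) hm)
    (by simpa only [ha] using hu) (by simpa only [hb] using hv)
  refine ⟨_, ⟨_, 0, T, C.isCausalCurve_chart_symm_comp hT hyt hyL hyd, ?_, rfl⟩,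
    fun i => γ i (t i), ?_, htt⟩
  · rw [Function.comp_apply, hy0, (chartAt E p).left_inv (mem_chart_source E p)]
  · filter_upwards [ht] with i hi
    rw [← ha i, ← hb i]
    exact ⟨(hγ i).causalLE (left_mem_Icc.2 (hγ i).1.le) hi hi.1,
      (hγ i).causalLE hi (right_mem_Icc.2 (hγ i).1.le) hi.2⟩

/-- If `uᵢ < vᵢ`, `uᵢ → p` and `vᵢ → q ≠ p`, then some `q' < q` is a limit of points causally
between `uᵢ` and `vᵢ`. The curves are run backwards, so that they follow the opposite cones. -/
theorem exists_limit_past [T2Space M] (C : ClosedConeStructure n M) {ι : Type*}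
    (𝒰 : Ultrafilter ι) {p q : M} (hpq : p ≠ q) {u v : ι → M} (huv : ∀ i, C.CausalLT (u i) (v i))
    (hu : Tendsto u 𝒰 (𝓝 p)) (hv : Tendsto v 𝒰 (𝓝 q)) :
    ∃ q' : M, C.CausalLT q' q ∧ ∃ r : ι → M,
      (∀ᶠ i in 𝒰, C.CausalLE (u i) (r i) ∧ C.CausalLE (r i) (v i)) ∧ Tendsto r 𝒰 (𝓝 q') := by
  choose γ a b hγ ha hb using huv
  have hneg : ∀ i, MapsTo Neg.neg (Icc (-b i) (-a i)) (Icc (a i) (b i)) := fun i t ht =>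
    ⟨by linarith [ht.2], by linarith [ht.1]⟩
  obtain ⟨T, hT, y, hy0, hyt, ⟨K, hK⟩, hyd, t, ht, htt⟩ :=
    FollowsCones.exists_limit_in_chart 𝒰 hpq.symm (G := fun y => -C.chartCone q y)
    (γ := fun i t => γ i (-t)) (a := fun i => -b i)
    (b := fun i => -a i)
    (fun B hB hBp => (C.isClosedConeField_chartCone q hB hBp).neg)
    (fun y w hw hw' => C.eq_zero_of_neg_mem_chartCone q y (by simpa using hw') hw)
    (fun i => neg_le_neg (hγ i).1.le)
    (fun i => (hγ i).2.1.1.comp continuousOn_neg (hneg i)) (fun i d hd hm => by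
      have hm' : MapsTo (γ i) (Icc (-d) (b i)) (chartAt E q).source := fun s hs => by
        simpa using hm (show -s ∈ Icc (-b i) d from ⟨by linarith [hs.2], by linarith [hs.1]⟩)
      simpa [Function.comp_def] using
        ((hγ i).followsCones (Icc_subset_Icc_left (by linarith [hd.2])) hm').neg)
    (by simpa only [neg_neg, hb] using hv) (by simpa only [neg_neg, ha] using hu)
  have hnegT : MapsTo Neg.neg (Icc (-T) 0) (Icc 0 T) := fun t ht =>
    ⟨by linarith [ht.2], by linarith [ht.1]⟩
  -- the limit curve, run backwards
  have hcurve : C.IsCausalCurve ((chartAt E q).symm ∘ fun s => y (-s)) (-T) 0 := by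
    refine C.isCausalCurve_chart_symm_comp (by linarith) (hyt.comp hnegT) ⟨K, ?_⟩ ?_
    · have : LipschitzOnWith 1 (fun s : ℝ => -s) (Icc (-T) 0) :=
        (LipschitzWith.of_dist_le_mul fun x y => by simp [dist_neg_neg]).lipschitzOnWith
      simpa [Function.comp_def] using hK.comp this hnegT
    · rw [ae_restrict_iff' measurableSet_Icc] at hyd ⊢
      filter_upwards [(Measure.measurePreserving_neg (volume : Measure ℝ)).quasiMeasurePreserving.ae
        hyd] with s hs hsI
      obtain ⟨w, hw, hw0, hd⟩ := hs (hnegT hsI)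
      have hd' := HasDerivAt.scomp s hd (hasDerivAt_neg s)
      rw [neg_one_smul] at hd'
      exact ⟨-w, hw, neg_ne_zero.2 hw0, hd'⟩
  refine ⟨(chartAt E q).symm (y T), ⟨_, -T, 0, hcurve, ?_, ?_⟩, fun i => γ i (-t i), ?_, htt⟩
  · simp
  · rw [Function.comp_apply, neg_zero, hy0, (chartAt E q).left_inv (mem_chart_source E q)]
  · filter_upwards [ht] with i hi
    have hi' := hneg i hi
    rw [← ha i, ← hb i]
    exact ⟨(hγ i).causalLE (left_mem_Icc.2 (hγ i).1.le) hi' hi'.1,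
      (hγ i).causalLE hi' (right_mem_Icc.2 (hγ i).1.le) hi'.2⟩

theorem isClosed_causalHull {C : ClosedConeStructure n M} (h : IsClosed C.causalRelation)
    {K : Set M} (hK : IsCompact K) : IsClosed (C.causalHull K) := by
  have : CompactSpace K := isCompact_iff_compactSpace.1 hK
  have h1 : C.causalFuture K = Prod.snd '' {x : K × M | ((x.1 : M), x.2) ∈ C.causalRelation} := by
    ext q
    constructor
    · rintro ⟨p, hp, hpq⟩
      exact ⟨(⟨p, hp⟩, q), hpq, rfl⟩
    · rintro ⟨⟨p, q'⟩, hpq, rfl⟩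
      exact ⟨p, p.2, hpq⟩
  have h2 : C.causalPast K = Prod.snd '' {x : K × M | (x.2, (x.1 : M)) ∈ C.causalRelation} := by
    ext q
    constructor
    · rintro ⟨p, hp, hpq⟩
      exact ⟨(⟨p, hp⟩, q), hpq, rfl⟩
    · rintro ⟨⟨p, q'⟩, hpq, rfl⟩
      exact ⟨p, p.2, hpq⟩
  rw [causalHull, h1, h2]
  exact (isClosedMap_snd_of_compactSpace _ (h.preimage (by fun_prop))).inter
    (isClosedMap_snd_of_compactSpace _ (h.preimage (by fun_prop)))

section Limits

variable [T2Space M] {C : ClosedConeStructure n M} {p q : M}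

/-- The case of a constant first sequence: if the hulls of compact sets are closed, `J⁺(p)` is
sequentially closed. -/
theorem causalLE_of_tendsto_right (hC : C.IsCausal)
    (H : ∀ K : Set M, IsCompact K → IsClosed (C.causalHull K)) {v : ℕ → M}
    (hpv : ∀ i, C.CausalLE p (v i)) (hv : Tendsto v atTop (𝓝 q)) : C.CausalLE p q := by
  by_cases hpq : p = q
  · exact Or.inr hpq
  obtain ⟨N, hN⟩ := eventually_atTop.1 (hv.eventually_ne (Ne.symm hpq))
  set v' : ℕ → M := fun i => v (i + N) with hv'
  have hv't : Tendsto v' atTop (𝓝 q) := hv.comp (tendsto_add_atTop_nat N)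
  have hlt : ∀ i, C.CausalLT p (v' i) := fun i =>
    (hpv (i + N)).resolve_right (hN _ (Nat.le_add_left N i)).symm
  obtain ⟨q', hq', r, hr, hrt⟩ := C.exists_limit_past (hyperfilter ℕ) hpq hlt tendsto_const_nhds
    (hv't.mono_left Nat.hyperfilter_le_atTop)
  set K : Set M := insert p (insert q (range v')) with hK
  have hKc : IsCompact K := (hv't.isCompact_insert_range).insert p
  obtain ⟨⟨x, hx, hxq⟩, -⟩ : q' ∈ C.causalHull K := by
    refine (H K hKc).mem_of_tendsto hrt ?_
    filter_upwards [hr] with i hi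
    exact ⟨⟨p, mem_insert _ _, hi.1⟩, ⟨v' i, Or.inr (Or.inr ⟨i, rfl⟩), hi.2⟩⟩
  rcases hx with rfl | rfl | ⟨i, rfl⟩
  · exact hxq.trans hq'.causalLE
  · exact absurd hxq (hC.not_causalLE_of_causalLT hq')
  · exact (hlt i).causalLE.trans (hxq.trans hq'.causalLE)

/-- If the hulls of compact sets are closed, `J` is sequentially closed. -/
theorem causalLE_of_tendsto (hC : C.IsCausal)
    (H : ∀ K : Set M, IsCompact K → IsClosed (C.causalHull K)) {u v : ℕ → M}
    (huv : ∀ i, C.CausalLE (u i) (v i)) (hu : Tendsto u atTop (𝓝 p))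
    (hv : Tendsto v atTop (𝓝 q)) : C.CausalLE p q := by
  by_cases hpq : p = q
  · exact Or.inr hpq
  obtain ⟨N, hN⟩ := eventually_atTop.1 ((hu.prodMk_nhds hv).eventually
    (isClosed_diagonal.isOpen_compl.mem_nhds (show (p, q) ∉ diagonal M from hpq)))
  obtain ⟨p', hp', r, hr, hrt⟩ := C.exists_limit_future (hyperfilter ℕ) hpq
    (fun i => (huv (i + N)).resolve_right (hN _ (Nat.le_add_left N i)))
    ((hu.comp (tendsto_add_atTop_nat N)).mono_left Nat.hyperfilter_le_atTop)
    ((hv.comp (tendsto_add_atTop_nat N)).mono_left Nat.hyperfilter_le_atTop)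
  by_cases hpq' : C.CausalLE p' q
  · exact hp'.causalLE.trans hpq'
  -- discarding finitely many terms of the two sequences keeps `p'` in the hull of what remains
  have key : ∀ m : ℕ, ∃ i ≥ m, C.CausalLE p' (v i) := by
    intro m
    set K : Set M := insert p (range fun i => u (i + m)) ∪ insert q (range fun i => v (i + m))
      with hK
    have hKc : IsCompact K := ((hu.comp (tendsto_add_atTop_nat m)).isCompact_insert_range).union
      ((hv.comp (tendsto_add_atTop_nat m)).isCompact_insert_range)
    have hge : ∀ᶠ i in (hyperfilter ℕ : Filter ℕ), m ≤ i :=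
      Nat.hyperfilter_le_atTop (eventually_ge_atTop m)
    obtain ⟨-, ⟨x, hx, hxp⟩⟩ : p' ∈ C.causalHull K := by
      refine (H K hKc).mem_of_tendsto hrt ?_
      filter_upwards [hr, hge] with i hi hmi
      exact ⟨⟨_, Or.inl (Or.inr ⟨i + N - m, by simp [Nat.sub_add_cancel (hmi.trans
          (Nat.le_add_right i N))]⟩), hi.1⟩,
        ⟨_, Or.inr (Or.inr ⟨i + N - m, by simp [Nat.sub_add_cancel (hmi.trans
          (Nat.le_add_right i N))]⟩), hi.2⟩⟩
    rcases hx with (rfl | ⟨i, rfl⟩) | (rfl | ⟨i, rfl⟩)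
    · exact absurd hxp (hC.not_causalLE_of_causalLT hp')
    · exact ⟨i + m, Nat.le_add_left m i, hxp.trans (huv _)⟩
    · exact absurd hxp hpq'
    · exact ⟨i + m, Nat.le_add_left m i, hxp⟩
  choose σ hσ hσv using key
  exact hp'.causalLE.trans (causalLE_of_tendsto_right hC H hσv
    (hv.comp (tendsto_atTop_mono hσ tendsto_id)))

end Limits

end ClosedConeStructure

theorem theorem5 {n : ℕ} {M : Type*} [TopologicalSpace M] [T2Space M] [SecondCountableTopology M]
    [ChartedSpace (EuclideanSpace ℝ (Fin n)) M] [IsManifold (𝓡 n) 1 M]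
    (C : ClosedConeStructure n M) (hC : C.IsCausal) :
    (∀ K : Set M, IsCompact K → IsClosed (C.causalHull K)) ↔ IsClosed C.causalRelation := by
  refine ⟨fun H => ?_, fun h K hK => ClosedConeStructure.isClosed_causalHull h hK⟩
  refine isClosed_of_closure_subset fun x hx => ?_
  obtain ⟨z, hz, hzx⟩ := mem_closure_iff_seq_limit.1 hx
  rw [nhds_prod_eq] at hzx
  exact ClosedConeStructure.causalLE_of_tendsto hC H hz hzx.fst hzx.snd
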